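/- Let $S^2\subset\mathbb R^3$ be the unit sphere with the round metric $d\theta^2+\sin^2\theta\,d\varphi^2$ in spherical coordinates ($\theta$ the angle from the north pole), let $\triangle$ and $\nabla$ be its Laplace–Beltrami operator and gradient, and let $L^2(S^2)$ be taken with respect to the area measure $\sin\theta\,d\theta\,d\varphi$. Put $\mathfrak a=\partial_\theta^2$ and $\mathfrak b=\cot\theta\,\partial_\theta$; for $l\ge 0$ let $\mathfrak c^l$ denote any product $\mathfrak c_1\cdots\mathfrak c_l$ in which each $\mathfrak c_j$ is either $\mathfrak a$ or $\mathfrak b$ (for $l=0$, the identity). Call $f:S^2\to\mathbb R$ axisymmetric if $f$ depends only on $\theta$. **Theorem.** For every integer $l\ge 0$ there is a constant $C=C(l)$ such that, for every one of the $2^l$ operators $\mathfrak c^l$: 1. for every axisymmetric $f\in C^{2l}(S^2)$, $$\|\mathfrak c^l f\|_{L^2(S^2)}\le C\sum_{i=0}^{l}\|\triangle^i f\|_{L^2(S^2)};$$ 2. for every axisymmetric $f\in C^{2l+1}(S^2)$, $$\|\partial_\theta\mathfrak c^l f\|_{L^2(S^2)}\le C\sum_{i=0}^{l}\|\nabla\triangle^i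 f\|_{L^2(S^2)}.$$ In particular both estimates hold for all smooth axisymmetric $f$. -/

import Mathlib

open MeasureTheory Set
open scoped Manifold ContDiff NNReal ENNReal

noncomputable section

namespace AxisymmetricSphere

instance fact_finrank : Fact (Module.finrank ℝ (EuclideanSpace ℝ (Fin 3)) = 2 + 1) :=
  ⟨by simp⟩

/-- The unit sphere `S²` in `ℝ³`, with Mathlib's smooth structure. -/
abbrev S2 : Type := Metric.sphere (0 : EuclideanSpace ℝ (Fin 3)) 1

/-- The point of `S²` with polar angle `θ` (measured from the north pole) and azimuth `φ`. -/
def sphPoint (θ φ : ℝ) : S2 :=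
  ⟨!₂[Real.sin θ * Real.cos φ, Real.sin θ * Real.sin φ, Real.cos θ], by
    rw [mem_sphere_zero_iff_norm, EuclideanSpace.norm_eq, Real.sqrt_eq_one, Fin.sum_univ_three]
    simp only [Real.norm_eq_abs, sq_abs]
    simp
    nlinarith [Real.sin_sq_add_cos_sq θ, Real.sin_sq_add_cos_sq φ]⟩

/-- `f` is axisymmetric: it depends only on the angle from the north pole, that is, only on the
height `x 2 = cos θ`. -/
def IsAxisymmetric (f : S2 → ℝ) : Prop :=
  ∀ x y : S2, (x : EuclideanSpace ℝ (Fin 3)) 2 = (y : EuclideanSpace ℝ (Fin 3)) 2 → f x = f y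

/-- Functions written in the spherical coordinates `(θ, φ)`. The coordinates are valid for
`0 < θ < π`, that is, on the sphere without the two poles (a null set); the values of the operators
below at such a `θ` depend only on the function near `θ`. -/
abbrev CoordFun : Type := ℝ → ℝ → ℝ

/-- A function on `S²` in spherical coordinates. -/
def inCoords (f : S2 → ℝ) : CoordFun := fun θ φ => f (sphPoint θ φ)

/-- `∂_θ` -/
def dTheta (u : CoordFun) : CoordFun := fun θ φ => deriv (fun t => u t φ) θ

/-- `∂_φ` -/
def dPhi (u : CoordFun) : CoordFun := fun θ φ => deriv (fun s => u θ s) φ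

/-- `𝔞 = ∂_θ²` -/
def opA (u : CoordFun) : CoordFun := dTheta (dTheta u)

/-- `𝔟 = cot θ ∂_θ` -/
def opB (u : CoordFun) : CoordFun := fun θ φ => Real.cot θ * dTheta u θ φ

/-- The family `𝔠^l` of all products `𝔠₁ ⋯ 𝔠_l` in which each factor is `𝔞` or `𝔟`. -/
def opC : ℕ → Set (CoordFun → CoordFun)
  | 0 => {id}
  | l + 1 => {T | ∃ S ∈ opC l, T = opA ∘ S ∨ T = opB ∘ S}

/-- The Laplace–Beltrami operator of the round metric `g = dθ² + sin² θ dφ²`, that is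
`(det g)^(-1/2) ∂_i ((det g)^(1/2) g^{ij} ∂_j u)` with `(det g)^(1/2) = sin θ`. -/
def sphLaplacian (u : CoordFun) : CoordFun := fun θ φ =>
  (Real.sin θ)⁻¹ *
    (dTheta (fun t s => Real.sin t * dTheta u t s) θ φ +
      dPhi (fun t s => Real.sin t * ((Real.sin t ^ 2)⁻¹ * dPhi u t s)) θ φ)

/-- The gradient of the round metric, by its components in the orthonormal frame
`e₁ = ∂_θ`, `e₂ = csc θ ∂_φ`. -/
def sphGradient (u : CoordFun) : ℝ → ℝ → EuclideanSpace ℝ (Fin 2) := fun θ φ =>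
  !₂[dTheta u θ φ, (Real.sin θ)⁻¹ * dPhi u θ φ]

/-- The area measure `sin θ dθ dφ` of the unit sphere, in the coordinates `(θ, φ)`. -/
def sphMeasure : Measure (ℝ × ℝ) :=
  (volume.restrict (Ioo 0 Real.pi ×ˢ Ioo 0 (2 * Real.pi))).withDensity
    (fun p => ENNReal.ofReal (Real.sin p.1))

/-- The `L²(S²)` norm of a function or frame-valued field, with value `∞` if it is not square
integrable. -/
def normL2 {E : Type*} [NormedAddCommGroup E] (u : ℝ → ℝ → E) : ℝ≥0∞ :=
  eLpNorm (fun p : ℝ × ℝ => u p.1 p.2) 2 sphMeasure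

end AxisymmetricSphere

end

namespace AxisymmetricSphere

/-! Followed along a full meridian circle, an axisymmetric function becomes a function `F` on the
line that is even about every zero of `sin`. Hence `F'` vanishes at the poles and `cot θ F'` extends
regularly through them (`contDiff_divSin`), so the problem is one-dimensional. Write a, b for the
two operators and D_α = a + α b; D_1 is the Laplacian.

Two facts carry the proof. The first is ellipticity: for α ≥ 1 both the L² norm and the L² norm of
the derivative satisfy P(b u) ≤ P(D_α u). When |D_α u|² sin θ (or its analogue for derivatives) is
expanded, the cross term is an exact derivative plus nonnegative terms. The second is the
commutation relation D_{α+2} b = b D_α - 2 D_α + 2α b (`letter_profB`): raising α by 2 cancels every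
singular term of the commutator.

The bound for words in a and b follows by induction on the length, for all α ≥ 1 at once
(`IsEllipticSeminorm.wordBound`). The innermost letter is a combination of D_α and b. After D_α a
shorter word remains. After b, the shorter word is bounded with α + 2 in place of α, and each
D_{α+2}^i b F is reduced to iterates of D_α by commutation, with ellipticity as the base case. -/

/-! ### Regularity of difference quotients. -/

theorem hasDerivAt_integral_pow_mul_comp {h : ℝ → ℝ} (hh : ContDiff ℝ 1 h) (a : ℝ) (m : ℕ)
    (t : ℝ) :
    HasDerivAt (fun t => ∫ s in (0 : ℝ)..1, s ^ m * h (a + s * (t - a)))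
      (∫ s in (0 : ℝ)..1, s ^ (m + 1) * deriv h (a + s * (t - a))) t := by
  have hc : Continuous h := hh.continuous
  have hd : Continuous (deriv h) := hh.continuous_deriv le_rfl
  have hcont : Continuous (fun p : ℝ × ℝ => p.2 ^ (m + 1) * deriv h (a + p.2 * (p.1 - a))) := by
    fun_prop
  -- A bound on a compact neighbourhood serves as the constant dominating function for
  -- differentiation under the integral.
  obtain ⟨B, hB⟩ := ((isCompact_Icc (a := t - 1) (b := t + 1)).prod
    (isCompact_Icc (a := (0 : ℝ)) (b := 1))).exists_bound_of_continuousOn hcont.continuousOn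
  refine (intervalIntegral.hasDerivAt_integral_of_dominated_loc_of_deriv_le
    (F := fun t s => s ^ m * h (a + s * (t - a)))
    (F' := fun t s => s ^ (m + 1) * deriv h (a + s * (t - a)))
    (bound := fun _ => B) (Icc_mem_nhds (a := t - 1) (b := t + 1) (by linarith) (by linarith))
    (.of_forall fun x => ?_) ?_ ?_ (.of_forall fun s hs x hx => ?_) (by simp)
    (.of_forall fun s _ x _ => ?_)).2
  · exact (by fun_prop : Continuous fun s => s ^ m * h (a + s * (x - a))).aestronglyMeasurable
  · exact (by fun_prop : Continuous fun s => s ^ m * h (a + s * (t - a))).intervalIntegrable _ _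
  · exact (by fun_prop :
      Continuous fun s => s ^ (m + 1) * deriv h (a + s * (t - a))).aestronglyMeasurable
  · rw [uIoc_of_le zero_le_one] at hs
    exact hB (x, s) ⟨hx, hs.1.le, hs.2⟩
  · have h1 : HasDerivAt (fun x => a + s * (x - a)) s x := by
      simpa using (((hasDerivAt_id x).sub_const a).const_mul s).const_add a
    have h2 := ((hh.differentiable one_ne_zero _).hasDerivAt.comp x h1).const_mul (s ^ m)
    refine h2.congr_deriv ?_
    ring

/-- Each derivative in `t` replaces `h` by `deriv h` and brings out a factor `s`; the weight `s ^ m`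
is there to make the induction close. -/
theorem contDiff_integral_pow_mul_comp (k : ℕ) : ∀ {h : ℝ → ℝ}, ContDiff ℝ k h →
    ∀ (a : ℝ) (m : ℕ), ContDiff ℝ k (fun t => ∫ s in (0 : ℝ)..1, s ^ m * h (a + s * (t - a))) := by
  induction k with
  | zero =>
    intro h hh a m
    have hc : Continuous h := hh.continuous
    refine contDiff_zero.2 (intervalIntegral.continuous_parametric_intervalIntegral_of_continuous'
      (f := fun t s => s ^ m * h (a + s * (t - a))) ?_ _ _)
    fun_prop
  | succ k ih =>
    intro h hh a m
    have hd := hasDerivAt_integral_pow_mul_comp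
      (hh.of_le (by norm_cast; omega) : ContDiff ℝ 1 h) a m
    push_cast
    refine contDiff_succ_iff_deriv.2 ⟨fun t => (hd t).differentiableAt, by simp, ?_⟩
    rw [show deriv _ = _ from funext fun t => (hd t).deriv]
    push_cast at hh
    exact ih (contDiff_succ_iff_deriv.1 hh).2.2 a (m + 1)

/-- Hadamard's lemma: the difference quotient is the integral of h'(a + s(t - a)) over s in [0, 1],
so only one derivative is lost. -/
theorem contDiff_dslope {k : ℕ} {h : ℝ → ℝ} (hh : ContDiff ℝ (k + 1) h) (a : ℝ) :
    ContDiff ℝ k (dslope h a) := by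
  have hd := (contDiff_succ_iff_deriv.1 hh).2.2
  have hc : Continuous (deriv h) := hd.continuous
  convert contDiff_integral_pow_mul_comp k hd a 0 using 1
  funext t
  by_cases hta : t = a
  · simp [hta]
  rw [dslope_of_ne _ hta, slope_def_field, div_eq_iff (sub_ne_zero.2 hta)]
  simp only [pow_zero, one_mul]
  rw [← intervalIntegral.integral_mul_const]
  have h1 : ∀ s ∈ uIcc (0 : ℝ) 1, HasDerivAt (fun s => h (a + s * (t - a)))
      (deriv h (a + s * (t - a)) * (t - a)) s := fun s _ =>
    ((hh.differentiable (by simp)) _).hasDerivAt.comp s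
      (by simpa using ((hasDerivAt_id s).mul_const (t - a)).const_add a)
  rw [intervalIntegral.integral_eq_sub_of_hasDerivAt h1
    (Continuous.intervalIntegrable (by fun_prop) _ _)]
  simp

/-! ### Division by the sine. -/

/-- The quotient `h / sin`, extended through the zeros of `sin` by l'Hôpital's rule. -/
noncomputable def divSin (h : ℝ → ℝ) (t : ℝ) : ℝ :=
  if Real.sin t = 0 then deriv h t / Real.cos t else h t / Real.sin t

theorem cos_sq_of_sin_eq_zero {a : ℝ} (ha : Real.sin a = 0) : Real.cos a ^ 2 = 1 := by
  have := Real.sin_sq_add_cos_sq a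
  simpa [ha] using this

theorem cos_ne_zero_of_sin_eq_zero {a : ℝ} (ha : Real.sin a = 0) : Real.cos a ≠ 0 := by
  intro h
  simpa [h] using cos_sq_of_sin_eq_zero ha

theorem sin_mul_divSin {h : ℝ → ℝ} (h0 : ∀ a, Real.sin a = 0 → h a = 0) (t : ℝ) :
    Real.sin t * divSin h t = h t := by
  by_cases ht : Real.sin t = 0
  · simp [ht, h0 t ht]
  · simp only [divSin, ht, if_false]
    field_simp

/-- Near a zero `a` of `sin`, `divSin h` is the quotient of the difference quotients of `h` and
`sin` based at `a`, and the denominator equals cos a ≠ 0 there. -/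
theorem contDiff_divSin {k : ℕ} {h : ℝ → ℝ} (hh : ContDiff ℝ (k + 1) h)
    (h0 : ∀ a, Real.sin a = 0 → h a = 0) : ContDiff ℝ k (divSin h) := by
  refine contDiff_iff_contDiffAt.2 fun a => ?_
  by_cases ha : Real.sin a = 0
  · have hs : ContDiff ℝ k (dslope Real.sin a) := contDiff_dslope Real.contDiff_sin a
    have hsa : dslope Real.sin a a ≠ 0 := by
      simpa using cos_ne_zero_of_sin_eq_zero ha
    refine ((contDiff_dslope hh a).contDiffAt.div hs.contDiffAt hsa).congr_of_eventuallyEq ?_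
    filter_upwards [hs.continuous.continuousAt.eventually_ne hsa] with t ht
    by_cases hta : t = a
    · subst hta
      simp [divSin, ha]
    · have hst : Real.sin t ≠ 0 := by
        intro h
        apply ht
        rw [dslope_of_ne _ hta, slope_def_field, h, ha]
        simp
      have := sub_ne_zero.2 hta
      simp only [divSin, hst, if_false, dslope_of_ne _ hta, slope_def_field, ha, h0 a ha, sub_zero,
        Pi.div_apply]
      field_simp
  · refine ((hh.of_le (by norm_cast; omega)).contDiffAt.div
      Real.contDiff_sin.contDiffAt ha).congr_of_eventuallyEq ?_
    filter_upwards [Real.continuous_sin.continuousAt.eventually_ne ha] with t ht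
    simp [divSin, ht]

/-! ### Profiles and the operators on them. -/

/-- `C^n` functions of the polar angle that are invariant under the reflections in the zeros of
`sin`, that is, the profiles of axisymmetric `C^n` functions on the sphere. -/
structure IsProfile (n : ℕ) (F : ℝ → ℝ) : Prop where
  contDiff : ContDiff ℝ n F
  refl : ∀ a, Real.sin a = 0 → ∀ t, F (2 * a - t) = F t

theorem IsProfile.of_le {m n : ℕ} {F : ℝ → ℝ} (hF : IsProfile n F) (h : m ≤ n) : IsProfile m F :=
  ⟨hF.contDiff.of_le (by exact_mod_cast h), hF.refl⟩

theorem IsProfile.continuous {n : ℕ} {F : ℝ → ℝ} (hF : IsProfile n F) : Continuous F :=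
  hF.contDiff.continuous

theorem IsProfile.add_smul {n : ℕ} {F G : ℝ → ℝ} (hF : IsProfile n F) (hG : IsProfile n G)
    (x y : ℝ) : IsProfile n (x • F + y • G) :=
  ⟨(hF.contDiff.const_smul x).add (hG.contDiff.const_smul y), fun a ha t => by
    simp [hF.refl a ha t, hG.refl a ha t]⟩

theorem IsProfile.contDiff_deriv {n : ℕ} {F : ℝ → ℝ} (hF : IsProfile (n + 1) F) :
    ContDiff ℝ n (deriv F) := by
  have := hF.contDiff
  push_cast at this
  exact this.deriv'

theorem deriv_reflect {F : ℝ → ℝ} {c : ℝ} {σ : ℝ} (h : ∀ t, F (c - t) = σ * F t) (t : ℝ) :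
    deriv F (c - t) = -σ * deriv F t := by
  have h1 : deriv (fun t => F (c - t)) t = σ * deriv F t := by
    rw [funext h, deriv_const_mul_field]
  rw [deriv_comp_const_sub] at h1
  linarith

theorem IsProfile.deriv_refl {n : ℕ} {F : ℝ → ℝ} (hF : IsProfile n F) {a : ℝ}
    (ha : Real.sin a = 0) (t : ℝ) : deriv F (2 * a - t) = -deriv F t := by
  simpa using deriv_reflect (σ := 1) (by simpa using hF.refl a ha) t

theorem IsProfile.deriv_eq_zero {n : ℕ} {F : ℝ → ℝ} (hF : IsProfile n F) (a : ℝ)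
    (ha : Real.sin a = 0) : deriv F a = 0 := by
  have := hF.deriv_refl ha a
  rw [show 2 * a - a = a by ring] at this
  linarith

/-- `∂_θ²` on profiles. -/
noncomputable def profA (F : ℝ → ℝ) : ℝ → ℝ := deriv (deriv F)

/-- `cot θ ∂_θ` on profiles, extended through the poles. -/
noncomputable def profB (F : ℝ → ℝ) : ℝ → ℝ := fun t => Real.cos t * divSin (deriv F) t

/-- The operator `x ∂_θ² + y cot θ ∂_θ` on profiles. -/
noncomputable def letter (x y : ℝ) (F : ℝ → ℝ) : ℝ → ℝ := x • profA F + y • profB F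

theorem IsProfile.profA {n : ℕ} {F : ℝ → ℝ} (hF : IsProfile (n + 2) F) :
    IsProfile n (profA F) := by
  refine ⟨?_, fun a ha t => ?_⟩
  · have := hF.contDiff_deriv
    push_cast at this
    exact this.deriv'
  · simpa [AxisymmetricSphere.profA] using
      deriv_reflect (σ := -1) (by simpa using hF.deriv_refl ha) t

theorem IsProfile.contDiff_divSin_deriv {n : ℕ} {F : ℝ → ℝ} (hF : IsProfile (n + 2) F) :
    ContDiff ℝ n (divSin (deriv F)) := by
  have := hF.contDiff_deriv
  push_cast at this
  exact contDiff_divSin this hF.deriv_eq_zero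

theorem IsProfile.profB {n : ℕ} {F : ℝ → ℝ} (hF : IsProfile (n + 2) F) :
    IsProfile n (profB F) := by
  refine ⟨Real.contDiff_cos.mul hF.contDiff_divSin_deriv, fun a ha t => ?_⟩
  -- The reflection negates both `sin` and `deriv F` and fixes `cos` and the second derivative, so
  -- both branches of `divSin` are even.
  have hs2 : Real.sin (2 * a) = 0 := by simp [Real.sin_two_mul, ha]
  have hc2 : Real.cos (2 * a) = 1 := by rw [Real.cos_two_mul, cos_sq_of_sin_eq_zero ha]; norm_num
  have hs : Real.sin (2 * a - t) = -Real.sin t := by simp [Real.sin_sub, hs2, hc2]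
  have hc : Real.cos (2 * a - t) = Real.cos t := by simp [Real.cos_sub, hs2, hc2]
  have hA : deriv (deriv F) (2 * a - t) = deriv (deriv F) t := hF.profA.refl a ha t
  simp only [AxisymmetricSphere.profB, divSin, hs, hc, hA, hF.deriv_refl ha, neg_eq_zero,
    neg_div_neg_eq]

theorem IsProfile.letter {n : ℕ} {F : ℝ → ℝ} (hF : IsProfile (n + 2) F) (x y : ℝ) :
    IsProfile n (letter x y F) :=
  hF.profA.add_smul hF.profB x y

theorem deriv_add_smul {F G : ℝ → ℝ} (hF : Differentiable ℝ F) (hG : Differentiable ℝ G)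
    (x y : ℝ) : deriv (x • F + y • G) = x • deriv F + y • deriv G := by
  funext t
  rw [deriv_add ((hF t).const_smul x) ((hG t).const_smul y), deriv_const_smul_field,
    deriv_const_smul_field]
  rfl

theorem divSin_add_smul {F G : ℝ → ℝ} (hF : Differentiable ℝ F) (hG : Differentiable ℝ G)
    (x y : ℝ) : divSin (x • F + y • G) = x • divSin F + y • divSin G := by
  funext t
  simp only [divSin, deriv_add_smul hF hG, Pi.add_apply, Pi.smul_apply, smul_eq_mul]
  split_ifs <;> ring

theorem IsProfile.differentiable {n : ℕ} {F : ℝ → ℝ} (hF : IsProfile (n + 1) F) :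
    Differentiable ℝ F :=
  hF.contDiff.differentiable (by simp)

theorem IsProfile.differentiable_deriv {n : ℕ} {F : ℝ → ℝ} (hF : IsProfile (n + 2) F) :
    Differentiable ℝ (deriv F) :=
  hF.contDiff_deriv.differentiable (by simp)

theorem profA_add_smul {n : ℕ} {F G : ℝ → ℝ} (hF : IsProfile (n + 2) F) (hG : IsProfile (n + 2) G)
    (x y : ℝ) : profA (x • F + y • G) = x • profA F + y • profA G := by
  rw [profA, deriv_add_smul hF.differentiable hG.differentiable,
    deriv_add_smul hF.differentiable_deriv hG.differentiable_deriv]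
  rfl

theorem profB_add_smul {n : ℕ} {F G : ℝ → ℝ} (hF : IsProfile (n + 2) F) (hG : IsProfile (n + 2) G)
    (x y : ℝ) : profB (x • F + y • G) = x • profB F + y • profB G := by
  funext t
  simp only [profB, deriv_add_smul hF.differentiable hG.differentiable,
    divSin_add_smul hF.differentiable_deriv hG.differentiable_deriv, Pi.add_apply, Pi.smul_apply,
    smul_eq_mul]
  ring

theorem letter_add_smul {n : ℕ} {F G : ℝ → ℝ} (hF : IsProfile (n + 2) F)
    (hG : IsProfile (n + 2) G) (p q x y : ℝ) :
    letter p q (x • F + y • G) = x • letter p q F + y • letter p q G := by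
  funext t
  simp only [letter, profA_add_smul hF hG, profB_add_smul hF hG, Pi.add_apply, Pi.smul_apply,
    smul_eq_mul]
  ring

theorem profB_of_sin_ne_zero (F : ℝ → ℝ) {t : ℝ} (ht : Real.sin t ≠ 0) :
    profB F t = Real.cos t * (deriv F t / Real.sin t) := by
  simp [profB, divSin, ht]

theorem dense_sin_ne_zero : Dense {t : ℝ | Real.sin t ≠ 0} := by
  refine (Set.Countable.dense_compl ℝ (s := {t : ℝ | Real.sin t = 0}) ?_)
  refine (Set.countable_range fun n : ℤ => n * Real.pi).mono fun t ht => ?_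
  exact Real.sin_eq_zero_iff.1 ht

/-- The commutation relation
`(∂² + (α + 2) cot ∂) cot ∂ = cot ∂ (∂² + α cot ∂) - 2 (∂² + α cot ∂) + 2 α cot ∂`. -/
theorem letter_profB {n : ℕ} {F : ℝ → ℝ} (hF : IsProfile (n + 4) F) (α : ℝ) :
    letter 1 (α + 2) (profB F) =
      (1 : ℝ) • profB (letter 1 α F) +
        (1 : ℝ) • ((-2 : ℝ) • letter 1 α F + (2 * α) • profB F) := by
  have hD : IsProfile (n + 2) (letter 1 α F) := hF.letter 1 α
  have hB : IsProfile (n + 2) (profB F) := hF.profB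
  -- Both sides are continuous, so it suffices to compare them where `sin` does not vanish and b is
  -- literally cot θ ∂_θ.
  refine Continuous.ext_on dense_sin_ne_zero (hB.letter _ _).continuous
    (hD.profB.add_smul ((hD.add_smul hB _ _).of_le (by omega)) 1 1).continuous fun t ht => ?_
  have ht' : Real.sin t ≠ 0 := ht
  have hev : ∀ s, Real.sin s ≠ 0 → ∀ᶠ r in nhds s, Real.sin r ≠ 0 := fun s hs =>
    Real.continuous_sin.continuousAt.eventually_ne hs
  have d1 : ∀ s, HasDerivAt (deriv F) (deriv (deriv F) s) s := fun s =>
    (hF.differentiable_deriv s).hasDerivAt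
  have c2 : ContDiff ℝ ((n + 1 : ℕ) + 1) (deriv (deriv F)) := by
    have := (IsProfile.profA (n := n + 2) hF).contDiff
    exact_mod_cast this
  have d2 : ∀ s, HasDerivAt (deriv (deriv F)) (deriv (deriv (deriv F)) s) s := fun s =>
    (c2.differentiable (by simp) s).hasDerivAt
  have e1 : ∀ s, Real.sin s ≠ 0 → deriv (profB F) s =
      Real.cos s * (deriv (deriv F) s / Real.sin s) - deriv F s / Real.sin s ^ 2 := by
    intro s hs
    have h1 : HasDerivAt (fun r => Real.cos r * (deriv F r / Real.sin r)) _ s :=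
      (Real.hasDerivAt_cos s).mul ((d1 s).div (Real.hasDerivAt_sin s) hs)
    rw [Filter.EventuallyEq.deriv_eq ((hev s hs).mono fun r hr => profB_of_sin_ne_zero F hr),
      h1.deriv]
    field_simp
    linear_combination -deriv F s * Real.sin_sq_add_cos_sq s
  have e2 : deriv (deriv (profB F)) t =
      Real.cos t * (deriv (deriv (deriv F)) t / Real.sin t)
        - 2 * (deriv (deriv F) t / Real.sin t ^ 2)
        + 2 * Real.cos t * deriv F t / Real.sin t ^ 3 := by
    have h1 : HasDerivAt (fun s => Real.cos s * (deriv (deriv F) s / Real.sin s)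
        - deriv F s / Real.sin s ^ 2) _ t :=
      ((Real.hasDerivAt_cos t).mul ((d2 t).div (Real.hasDerivAt_sin t) ht)).sub
        ((d1 t).div ((Real.hasDerivAt_sin t).pow 2) (pow_ne_zero 2 ht))
    rw [Filter.EventuallyEq.deriv_eq ((hev t ht).mono fun r hr => e1 r hr), h1.deriv]
    simp only [Nat.cast_ofNat, Nat.add_one_sub_one, pow_one, Pi.div_apply]
    field_simp
    linear_combination -(deriv (deriv F) t) * Real.sin t * Real.sin_sq_add_cos_sq t
  have e3 : deriv (letter 1 α F) t = deriv (deriv (deriv F)) t +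
      α * (Real.cos t * (deriv (deriv F) t / Real.sin t) - deriv F t / Real.sin t ^ 2) := by
    have h1 : deriv (letter 1 α F) = (1 : ℝ) • deriv (profA F) + α • deriv (profB F) :=
      deriv_add_smul (IsProfile.profA (n := n + 2) hF).differentiable hB.differentiable _ _
    rw [h1]
    simp [e1 t ht, profA]
  have e4 : letter 1 (α + 2) (profB F) t = 1 * deriv (deriv (profB F)) t
      + (α + 2) * profB (profB F) t := rfl
  have e5 : letter 1 α F t = 1 * deriv (deriv F) t + α * profB F t := rfl
  simp only [Pi.add_apply, Pi.smul_apply, smul_eq_mul, e4, e5, profB_of_sin_ne_zero _ ht', e2,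
    e1 t ht, e3]
  field_simp
  linear_combination 2 * Real.sin t * deriv (deriv F) t * Real.sin_sq_add_cos_sq t

/-! ### Words in the operators. -/

/-- The product `L₁ ⋯ L_n` of the operators `L_i = x_i ∂_θ² + y_i cot θ ∂_θ` on profiles. -/
noncomputable def wordOp (w : List (ℝ × ℝ)) (F : ℝ → ℝ) : ℝ → ℝ :=
  w.foldr (fun p G => letter p.1 p.2 G) F

theorem wordOp_concat (w : List (ℝ × ℝ)) (p : ℝ × ℝ) (F : ℝ → ℝ) :
    wordOp (w ++ [p]) F = wordOp w (letter p.1 p.2 F) := by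
  simp [wordOp]

theorem wordOp_replicate (i : ℕ) (x y : ℝ) (F : ℝ → ℝ) :
    wordOp (List.replicate i (x, y)) F = (letter x y)^[i] F := by
  induction i with
  | zero => rfl
  | succ i ih => rw [Function.iterate_succ_apply', ← ih]; rfl

theorem IsProfile.wordOp {k : ℕ} (w : List (ℝ × ℝ)) : ∀ {n : ℕ} {F : ℝ → ℝ}, IsProfile n F →
    k + 2 * w.length ≤ n → IsProfile k (wordOp w F) := by
  induction w generalizing k with
  | nil => exact fun hF h => hF.of_le h
  | cons p w ih =>
    intro n F hF h
    rw [List.length_cons] at h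
    exact (ih (k := k + 2) hF (by omega)).letter p.1 p.2

theorem wordOp_add_smul (w : List (ℝ × ℝ)) {n : ℕ} {F G : ℝ → ℝ} (hF : IsProfile n F)
    (hG : IsProfile n G) (h : 2 * w.length ≤ n) (x y : ℝ) :
    wordOp w (x • F + y • G) = x • wordOp w F + y • wordOp w G := by
  induction w with
  | nil => rfl
  | cons p w ih =>
    rw [List.length_cons] at h
    have := letter_add_smul (n := 0) (IsProfile.wordOp (k := 2) w hF (by omega))
      (IsProfile.wordOp (k := 2) w hG (by omega)) p.1 p.2 x y
    rw [← ih (by omega)] at this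
    exact this

/-! ### Induction on word length for an elliptic seminorm. -/

/-- A seminorm on profiles of class `C^r` that controls `cot θ ∂_θ u` by
`(∂_θ² + α cot θ ∂_θ) u` for all `α ≥ 1`. -/
structure IsEllipticSeminorm (r : ℕ) (P : (ℝ → ℝ) → ℝ≥0∞) : Prop where
  add_smul_le : ∀ {F G : ℝ → ℝ}, IsProfile r F → IsProfile r G → ∀ x y : ℝ,
    P (x • F + y • G) ≤ ‖x‖₊ * P F + ‖y‖₊ * P G
  profB_le : ∀ {α : ℝ}, 1 ≤ α → ∀ {u : ℝ → ℝ}, IsProfile (r + 2) u →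
    P (profB u) ≤ P (letter 1 α u)

/-- The sum of the seminorms of `F, D F, …, D^n F` with `D = ∂_θ² + α cot θ ∂_θ`. -/
noncomputable def iterSum (P : (ℝ → ℝ) → ℝ≥0∞) (α : ℝ) (n : ℕ) (F : ℝ → ℝ) : ℝ≥0∞ :=
  ∑ i ∈ Finset.range (n + 1), P ((letter 1 α)^[i] F)

theorem iterSum_mono (P : (ℝ → ℝ) → ℝ≥0∞) (α : ℝ) (F : ℝ → ℝ) {m n : ℕ} (h : m ≤ n) :
    iterSum P α m F ≤ iterSum P α n F :=
  Finset.sum_le_sum_of_subset (Finset.range_mono (by omega))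

theorem iterSum_letter_le (P : (ℝ → ℝ) → ℝ≥0∞) (α : ℝ) (n : ℕ) (F : ℝ → ℝ) :
    iterSum P α n (letter 1 α F) ≤ iterSum P α (n + 1) F := by
  rw [iterSum, iterSum, Finset.sum_range_succ' _ (n + 1)]
  exact le_self_add

theorem le_iterSum (P : (ℝ → ℝ) → ℝ≥0∞) (α : ℝ) {i n : ℕ} (h : i ≤ n) (F : ℝ → ℝ) :
    P ((letter 1 α)^[i] F) ≤ iterSum P α n F :=
  Finset.single_le_sum (f := fun i => P ((letter 1 α)^[i] F)) (fun _ _ => zero_le)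
    (Finset.mem_range.2 (by omega))

/-- All words of length `n` are bounded by the iterates of each `∂_θ² + α cot θ ∂_θ`, `α ≥ 1`. -/
def WordBound (r : ℕ) (P : (ℝ → ℝ) → ℝ≥0∞) (n : ℕ) : Prop :=
  ∀ α : ℝ, 1 ≤ α → ∀ w : List (ℝ × ℝ), w.length = n → ∃ C : ℝ≥0, ∀ F : ℝ → ℝ,
    IsProfile (r + 2 * n) F → P (wordOp w F) ≤ C * iterSum P α n F

/-- The factors D_{α+2} are moved past b one at a time by `letter_profB`; once none is left,
ellipticity removes b. The terms without b are shorter words, which is why the word bound is assumed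
below `i`. -/
theorem IsEllipticSeminorm.iterate_profB_le {r : ℕ} {P : (ℝ → ℝ) → ℝ≥0∞}
    (hP : IsEllipticSeminorm r P) {α : ℝ} (hα : 1 ≤ α) (i : ℕ)
    (hW : ∀ j < i, WordBound r P j) :
    ∃ C : ℝ≥0, ∀ F : ℝ → ℝ, IsProfile (r + 2 * (i + 1)) F →
      P ((letter 1 (α + 2))^[i] (profB F)) ≤ C * iterSum P α (i + 1) F := by
  induction i with
  | zero =>
    refine ⟨1, fun F hF => ?_⟩
    rw [ENNReal.coe_one, one_mul]
    exact (hP.profB_le hα hF).trans (le_iterSum P α (i := 1) le_rfl F)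
  | succ i ih =>
    obtain ⟨C, hC⟩ := ih fun j hj => hW j (by omega)
    obtain ⟨K, hK⟩ := hW i (by omega) α hα (List.replicate i (1, α + 2)) (by simp)
    refine ⟨C + (‖(-2 : ℝ)‖₊ * K + ‖2 * α‖₊ * C), fun F hF => ?_⟩
    have hF4 : IsProfile (r + 2 * i + 4) F := hF.of_le (by omega)
    have hD : IsProfile (r + 2 * i + 2) (letter 1 α F) := hF4.letter 1 α
    have hB : IsProfile (r + 2 * i + 2) (profB F) := hF4.profB
    have hBD : IsProfile (r + 2 * i) (profB (letter 1 α F)) := hD.profB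
    have hlen : (List.replicate i ((1 : ℝ), α + 2)).length = i := List.length_replicate
    -- One factor crosses b, and the remaining D_{α+2}^i distributes over the three terms. The terms
    -- with b fall to the inductive hypothesis at D_α F and at `F`; the middle one is a word of
    -- length `i` applied to D_α F.
    rw [Function.iterate_succ_apply, letter_profB hF4, ← wordOp_replicate,
      wordOp_add_smul _ hBD ((hD.add_smul hB _ _).of_le (by omega)) (by omega),
      wordOp_add_smul _ hD hB (by omega)]
    have p1 : IsProfile r (wordOp (List.replicate i (1, α + 2)) (profB (letter 1 α F))) :=
      hBD.wordOp _ (by omega)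
    have p2 : IsProfile r (wordOp (List.replicate i (1, α + 2)) (letter 1 α F)) :=
      hD.wordOp _ (by omega)
    have p3 : IsProfile r (wordOp (List.replicate i (1, α + 2)) (profB F)) :=
      hB.wordOp _ (by omega)
    have b1 := (hC _ (hD.of_le (by omega))).trans
      (mul_le_mul_right (iterSum_letter_le P α (i + 1) F) (C : ℝ≥0∞))
    have b2 := (hK _ (hD.of_le (by omega))).trans
      (mul_le_mul_right ((iterSum_letter_le P α i F).trans
        (iterSum_mono P α F (Nat.le_succ _))) (K : ℝ≥0∞))
    have b3 := (hC F (hF.of_le (by omega))).trans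
      (mul_le_mul_right (iterSum_mono P α F (Nat.le_succ _)) (C : ℝ≥0∞))
    rw [← wordOp_replicate] at b1 b3
    refine (hP.add_smul_le p1 (p2.add_smul p3 _ _) _ _).trans ?_
    rw [nnnorm_one, ENNReal.coe_one, one_mul, one_mul]
    refine (add_le_add b1 ((hP.add_smul_le p2 p3 _ _).trans
      (add_le_add (mul_le_mul_right b2 _) (mul_le_mul_right b3 _)))).trans (le_of_eq ?_)
    push_cast
    ring

theorem IsEllipticSeminorm.wordBound {r : ℕ} {P : (ℝ → ℝ) → ℝ≥0∞}
    (hP : IsEllipticSeminorm r P) (n : ℕ) : WordBound r P n := by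
  induction n using Nat.strong_induction_on with
  | _ n ih =>
    intro α hα w hw
    rcases List.eq_nil_or_concat w with rfl | ⟨w, p, rfl⟩
    · refine ⟨1, fun F _ => ?_⟩
      rw [ENNReal.coe_one, one_mul]
      exact le_iterSum P α (i := 0) (Nat.zero_le _) F
    rw [List.concat_eq_append] at hw ⊢
    obtain ⟨m, rfl⟩ : ∃ m, n = m + 1 := ⟨w.length, by simpa using hw.symm⟩
    have hwm : w.length = m := by simpa using hw
    obtain ⟨K, hK⟩ := ih m (by omega) α hα w hwm
    -- This instance with α + 2 is applied to b F, since D_{α+2} is the operator that commutes well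
    -- with b.
    obtain ⟨M, hM⟩ := ih m (by omega) (α + 2) (by linarith) w hwm
    have hX : ∀ i ∈ Finset.range (m + 1), ∃ C : ℝ≥0, ∀ F : ℝ → ℝ, IsProfile (r + 2 * (m + 1)) F →
        P ((letter 1 (α + 2))^[i] (profB F)) ≤ C * iterSum P α (m + 1) F := by
      intro i hi
      rw [Finset.mem_range] at hi
      obtain ⟨C, hC⟩ := hP.iterate_profB_le hα i fun j hj => ih j (by omega)
      exact ⟨C, fun F hF => (hC F (hF.of_le (by omega))).trans
        (mul_le_mul_right (iterSum_mono P α F (by omega)) _)⟩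
    choose! c hc using hX
    refine ⟨‖p.1‖₊ * K + ‖p.2 - α * p.1‖₊ * (M * ∑ i ∈ Finset.range (m + 1), c i), fun F hF => ?_⟩
    have hF2 : IsProfile (r + 2 * m + 2) F := hF.of_le (by omega)
    have hD : IsProfile (r + 2 * m) (letter 1 α F) := hF2.letter 1 α
    have hB : IsProfile (r + 2 * m) (profB F) := hF2.profB
    -- The innermost letter is rewritten in terms of D_α and b.
    have hL : letter p.1 p.2 F = p.1 • letter 1 α F + (p.2 - α * p.1) • profB F := by
      funext t
      simp only [letter, Pi.add_apply, Pi.smul_apply, smul_eq_mul]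
      ring
    rw [wordOp_concat, hL, wordOp_add_smul w hD hB (by omega)]
    refine (hP.add_smul_le (hD.wordOp w (by omega)) (hB.wordOp w (by omega)) _ _).trans ?_
    have b1 := (hK _ hD).trans (mul_le_mul_right (iterSum_letter_le P α m F) (K : ℝ≥0∞))
    have b2 : P (wordOp w (profB F)) ≤
        M * ((∑ i ∈ Finset.range (m + 1), (c i : ℝ≥0∞)) * iterSum P α (m + 1) F) := by
      refine (hM _ hB).trans (mul_le_mul_right ?_ _)
      rw [Finset.sum_mul]
      exact Finset.sum_le_sum fun i hi => hc i hi F hF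
    refine (add_le_add (mul_le_mul_right b1 _) (mul_le_mul_right b2 _)).trans (le_of_eq ?_)
    push_cast
    ring

/-! ### The norm as an integral over the polar angle. -/

/-- The `L²(S²)` norm of a function of the polar angle. -/
noncomputable def profNorm (F : ℝ → ℝ) : ℝ≥0∞ := normL2 fun θ _ => F θ

theorem ae_sphMeasure : ∀ᵐ p ∂sphMeasure, p ∈ Ioo 0 Real.pi ×ˢ Ioo 0 (2 * Real.pi) :=
  (withDensity_absolutelyContinuous _ _).ae_le
    (ae_restrict_mem (measurableSet_Ioo.prod measurableSet_Ioo))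

theorem normL2_congr {E E' : Type*} [NormedAddCommGroup E] [NormedAddCommGroup E']
    {u : ℝ → ℝ → E} {v : ℝ → ℝ → E'} (h : ∀ θ ∈ Ioo 0 Real.pi, ∀ φ, ‖u θ φ‖ = ‖v θ φ‖) :
    normL2 u = normL2 v :=
  eLpNorm_congr_norm_ae (ae_sphMeasure.mono fun p hp => h p.1 hp.1 p.2)

theorem profNorm_add_smul_le {F G : ℝ → ℝ} (hF : Continuous F) (hG : Continuous G) (x y : ℝ) :
    profNorm (x • F + y • G) ≤ ‖x‖₊ * profNorm F + ‖y‖₊ * profNorm G := by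
  have hf : AEStronglyMeasurable (fun p : ℝ × ℝ => F p.1) sphMeasure :=
    (hF.comp continuous_fst).aestronglyMeasurable
  have hg : AEStronglyMeasurable (fun p : ℝ × ℝ => G p.1) sphMeasure :=
    (hG.comp continuous_fst).aestronglyMeasurable
  have h := eLpNorm_add_le (p := 2) (hf.const_smul x) (hg.const_smul y) one_le_two
  rw [eLpNorm_const_smul, eLpNorm_const_smul] at h
  exact h

/-- Fubini splits off the azimuth as a common factor, so comparing norms amounts to comparing
integrals over `θ`. -/
theorem profNorm_eq {F : ℝ → ℝ} (hF : Continuous F) :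
    profNorm F = (ENNReal.ofReal (∫ θ in (0 : ℝ)..Real.pi, F θ ^ 2 * Real.sin θ) *
      volume (Ioo 0 (2 * Real.pi))) ^ (1 / 2 : ℝ) := by
  have hm : Measurable fun p : ℝ × ℝ => ‖F p.1‖ₑ ^ (2 : ℝ) :=
    ((hF.measurable.comp measurable_fst).enorm).pow_const _
  have hs : Measurable fun p : ℝ × ℝ => ENNReal.ofReal (Real.sin p.1) := by fun_prop
  rw [profNorm, normL2, eLpNorm_eq_lintegral_rpow_enorm_toReal two_ne_zero ENNReal.ofNat_ne_top]
  simp only [ENNReal.toReal_ofNat]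
  congr 1
  rw [sphMeasure, lintegral_withDensity_eq_lintegral_mul _ hs hm, Measure.volume_eq_prod,
    ← Measure.prod_restrict, lintegral_prod _ (hs.mul hm).aemeasurable]
  simp only [Pi.mul_apply, lintegral_const, Measure.restrict_apply_univ]
  rw [lintegral_mul_const _ (by fun_prop)]
  congr 1
  rw [intervalIntegral.integral_of_le Real.pi_pos.le, integral_Ioc_eq_integral_Ioo,
    ofReal_integral_eq_lintegral_ofReal]
  · refine setLIntegral_congr_fun measurableSet_Ioo fun θ hθ => ?_
    rw [mul_comm (F θ ^ 2), ENNReal.ofReal_mul (Real.sin_pos_of_mem_Ioo hθ).le]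
    congr 1
    rw [← ofReal_norm, ENNReal.ofReal_rpow_of_nonneg (norm_nonneg _) zero_le_two]
    simp
  · exact ((by fun_prop : Continuous fun θ => F θ ^ 2 * Real.sin θ).integrableOn_Icc).mono_set
      Ioo_subset_Icc_self
  · exact (ae_restrict_mem measurableSet_Ioo).mono fun θ hθ =>
      mul_nonneg (sq_nonneg _) (Real.sin_pos_of_mem_Ioo hθ).le

theorem profNorm_le_of_integral_le {F G : ℝ → ℝ} (hF : Continuous F) (hG : Continuous G)
    (h : ∫ θ in (0 : ℝ)..Real.pi, F θ ^ 2 * Real.sin θ ≤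
      ∫ θ in (0 : ℝ)..Real.pi, G θ ^ 2 * Real.sin θ) : profNorm F ≤ profNorm G := by
  rw [profNorm_eq hF, profNorm_eq hG]
  gcongr

/-- If `(G² - F²) sin` is at least the derivative of a function with equal values at both ends,
then the norm of `F` is at most that of `G`. -/
theorem profNorm_le_of_hasDerivAt {F G Q R : ℝ → ℝ} (hF : Continuous F) (hG : Continuous G)
    (hR : Continuous R) (hQ : ∀ t, HasDerivAt Q (R t) t) (h0 : Q Real.pi = Q 0)
    (h : ∀ t ∈ Icc 0 Real.pi, F t ^ 2 * Real.sin t + R t ≤ G t ^ 2 * Real.sin t) :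
    profNorm F ≤ profNorm G := by
  refine profNorm_le_of_integral_le hF hG ?_
  have hI : ∫ t in (0 : ℝ)..Real.pi, R t = 0 := by
    rw [intervalIntegral.integral_eq_sub_of_hasDerivAt (fun t _ => hQ t)
      (hR.intervalIntegrable _ _), h0, sub_self]
  have hFi : IntervalIntegrable (fun θ => F θ ^ 2 * Real.sin θ) volume 0 Real.pi :=
    (by fun_prop : Continuous fun θ => F θ ^ 2 * Real.sin θ).intervalIntegrable _ _
  have hGi : IntervalIntegrable (fun θ => G θ ^ 2 * Real.sin θ) volume 0 Real.pi :=
    (by fun_prop : Continuous fun θ => G θ ^ 2 * Real.sin θ).intervalIntegrable _ _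
  have := intervalIntegral.integral_mono_on Real.pi_pos.le
    (hFi.add (hR.intervalIntegrable 0 Real.pi)) hGi h
  rwa [intervalIntegral.integral_add hFi (hR.intervalIntegrable _ _), hI, add_zero] at this

/-! ### The two elliptic inequalities. -/

/-- Since sin θ · b u = cos θ · u', the cross term 2α u'' (b u) sin θ equals (α u'² cos θ)' + α u'²
sin θ. Integrating over [0, π], ∫ |D_α u|² sin = ∫ (u''² + α u'² + α² (b u)²) sin. -/
theorem isEllipticSeminorm_profNorm : IsEllipticSeminorm 0 profNorm where
  add_smul_le hF hG x y := profNorm_add_smul_le hF.continuous hG.continuous x y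
  profB_le := by
    intro α hα u hu
    have hA : Continuous (deriv (deriv u)) := (IsProfile.profA (n := 0) hu).continuous
    have hp : Continuous (deriv u) := (hu.differentiable_deriv (n := 0)).continuous
    have hB : Continuous (profB u) := (IsProfile.profB (n := 0) hu).continuous
    refine profNorm_le_of_hasDerivAt
      (Q := fun t => α * (deriv u t ^ 2 * Real.cos t))
      (R := fun t => α * (2 * deriv u t * deriv (deriv u) t * Real.cos t
        - deriv u t ^ 2 * Real.sin t)) hB
      (IsProfile.letter (n := 0) hu 1 α).continuous (by fun_prop) (fun t => ?_) ?_ fun t ht => ?_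
    · refine (((((hu.differentiable_deriv (n := 0)) t).hasDerivAt.pow 2).mul
        (Real.hasDerivAt_cos t)).const_mul α).congr_deriv ?_
      simp [-mul_eq_mul_left_iff]
      ring
    -- The boundary terms vanish because u' is zero at the poles.
    · simp [hu.deriv_eq_zero]
    · have hs : 0 ≤ Real.sin t := Real.sin_nonneg_of_mem_Icc ht
      have hBs : Real.sin t * profB u t = Real.cos t * deriv u t := by
        rw [profB, mul_left_comm, sin_mul_divSin hu.deriv_eq_zero]
      have hL : letter 1 α u t = deriv (deriv u) t + α * profB u t := by
        simp [letter, profA]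
      have h1 : 0 ≤ (deriv (deriv u) t) ^ 2 * Real.sin t := by positivity
      have h2 : 0 ≤ α * (deriv u t ^ 2 * Real.sin t) := by positivity
      -- Here α ≥ 1 enters: the coefficient α² of (b u)² is at least 1.
      have h3 : 0 ≤ (α ^ 2 - 1) * (profB u t ^ 2 * Real.sin t) :=
        mul_nonneg (by nlinarith) (by positivity)
      rw [hL]
      linear_combination h1 + h2 + h3 - 2 * α * deriv (deriv u) t * hBs

/-- With g = u'/sin θ one has sin θ (b u)' = cos θ u'' - g, so the cross term is 2α u''' (cos θ u''
- g). Subtracting the derivative of `Q` leaves α (u''² + g² + 2 g'²) sin θ, by u'' = cos θ g + sin θ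
g'. -/
theorem isEllipticSeminorm_profNorm_deriv :
    IsEllipticSeminorm 1 fun F => profNorm (deriv F) where
  add_smul_le hF hG x y := by
    have hF' := (hF.contDiff_deriv (n := 0)).continuous
    have hG' := (hG.contDiff_deriv (n := 0)).continuous
    rw [deriv_add_smul (hF.differentiable (n := 0)) (hG.differentiable (n := 0))]
    exact profNorm_add_smul_le hF' hG' x y
  profB_le := by
    intro α hα u hu
    have hA : ContDiff ℝ ((0 : ℕ) + 1) (deriv (deriv u)) := by
      simpa [profA] using (IsProfile.profA (n := 1) hu).contDiff
    have hg : ContDiff ℝ ((0 : ℕ) + 1) (divSin (deriv u)) := by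
      simpa using hu.contDiff_divSin_deriv (n := 1)
    set g := divSin (deriv u) with hgdef
    have hAd := hA.differentiable (by simp)
    have hgd := hg.differentiable (by simp)
    have hA' : Continuous (deriv (deriv (deriv u))) := hA.deriv'.continuous
    have hg' : Continuous (deriv g) := hg.deriv'.continuous
    have hAc := hA.continuous
    have hgc := hg.continuous
    have hp : deriv u = fun t => Real.sin t * g t :=
      funext fun t => (sin_mul_divSin hu.deriv_eq_zero t).symm
    have hv : ∀ t, deriv (deriv u) t = Real.cos t * g t + Real.sin t * deriv g t := fun t => by
      rw [hp]
      exact ((Real.hasDerivAt_sin t).mul (hgd t).hasDerivAt).deriv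
    have hw : ∀ t, deriv (profB u) t = -Real.sin t * g t + Real.cos t * deriv g t := fun t =>
      ((Real.hasDerivAt_cos t).mul (hgd t).hasDerivAt).deriv
    have hL : ∀ t, deriv (letter 1 α u) t =
        deriv (deriv (deriv u)) t + α * deriv (profB u) t := fun t => by
      rw [letter, deriv_add_smul (IsProfile.profA (n := 1) hu).differentiable
        (IsProfile.profB (n := 1) hu).differentiable]
      simp [profA]
    have hwc : Continuous (deriv (profB u)) := by
      rw [funext hw]
      fun_prop
    have hLc : Continuous (deriv (letter 1 α u)) := by
      rw [funext hL]
      fun_prop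
    refine profNorm_le_of_hasDerivAt
      (Q := fun t => α * (deriv (deriv u) t ^ 2 * Real.cos t - 2 * (deriv (deriv u) t * g t)
        + g t ^ 2 * Real.cos t))
      (R := fun t => α * (2 * deriv (deriv u) t * deriv (deriv (deriv u)) t * Real.cos t
        - deriv (deriv u) t ^ 2 * Real.sin t - 2 * (deriv (deriv (deriv u)) t * g t
        + deriv (deriv u) t * deriv g t) + 2 * g t * deriv g t * Real.cos t
        - g t ^ 2 * Real.sin t)) hwc hLc (by fun_prop) (fun t => ?_) ?_ fun t ht => ?_
    · have h1 := ((hAd t).hasDerivAt.pow 2).mul (Real.hasDerivAt_cos t)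
      have h2 := ((hAd t).hasDerivAt.mul (hgd t).hasDerivAt).const_mul 2
      have h3 := ((hgd t).hasDerivAt.pow 2).mul (Real.hasDerivAt_cos t)
      refine (((h1.sub h2).add h3).const_mul α).congr_deriv ?_
      simp [-mul_eq_mul_left_iff]
      ring
    -- At a pole u'' = cos θ g with cos θ = ±1, so the three terms of `Q` cancel.
    · simp [hv, -mul_eq_mul_left_iff]
      ring
    · have hs : 0 ≤ Real.sin t := Real.sin_nonneg_of_mem_Icc ht
      have h1 : 0 ≤ (deriv (deriv (deriv u)) t) ^ 2 * Real.sin t := by positivity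
      have h2 : 0 ≤ α * (deriv (deriv u) t ^ 2 * Real.sin t) := by positivity
      have h3 : 0 ≤ α * (g t ^ 2 * Real.sin t) := by positivity
      have h4 : 0 ≤ 2 * α * (deriv g t ^ 2 * Real.sin t) := by positivity
      have h5 : 0 ≤ (α ^ 2 - 1) * (deriv (profB u) t ^ 2 * Real.sin t) :=
        mul_nonneg (by nlinarith) (by positivity)
      have h6 : Real.sin t * deriv (profB u) t = Real.cos t * deriv (deriv u) t - g t := by
        rw [hw, hv]
        linear_combination -g t * Real.sin_sq_add_cos_sq t
      have h7 : deriv (deriv u) t * deriv g t =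
        Real.cos t * g t * deriv g t + Real.sin t * deriv g t ^ 2 := by rw [hv]; ring
      rw [hL]
      linear_combination h1 + h2 + h3 + h4 + h5
        - 2 * α * deriv (deriv (deriv u)) t * h6 - 2 * α * h7

/-! ### From the sphere to profiles. -/

/-- Letting `θ` run over all of ℝ gives a great circle passing smoothly through both poles; this
carries the regularity of `f` at the poles over to its profile. -/
theorem contMDiff_sphPoint (n : ℕ∞ω) : ContMDiff 𝓘(ℝ, ℝ) (𝓡 2) n fun θ => sphPoint θ 0 := by
  have h : ContDiff ℝ n fun θ => (sphPoint θ 0 : EuclideanSpace ℝ (Fin 3)) := by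
    rw [contDiff_euclidean]
    intro i
    fin_cases i
    · simpa [sphPoint] using Real.contDiff_sin
    · simpa [sphPoint] using contDiff_const
    · simpa [sphPoint] using Real.contDiff_cos
  exact h.contMDiff.codRestrict_sphere fun θ => (sphPoint θ 0).2

theorem IsAxisymmetric.inCoords_eq {f : S2 → ℝ} (hf : IsAxisymmetric f) {θ θ' : ℝ}
    (h : Real.cos θ = Real.cos θ') (φ φ' : ℝ) : inCoords f θ φ = inCoords f θ' φ' :=
  hf _ _ (by simpa [sphPoint] using h)

theorem IsAxisymmetric.isProfile {f : S2 → ℝ} (hf : IsAxisymmetric f) {n : ℕ}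
    (hn : ContMDiff (𝓡 2) 𝓘(ℝ, ℝ) (n : ℕ∞ω) f) : IsProfile n fun θ => inCoords f θ 0 := by
  refine ⟨(hn.comp (contMDiff_sphPoint n)).contDiff, fun a ha t => hf.inCoords_eq ?_ 0 0⟩
  rw [Real.cos_sub, Real.sin_two_mul, Real.cos_two_mul, cos_sq_of_sin_eq_zero ha, ha]
  ring

/-- The coordinate function `u` is given by the profile `F` away from the poles. -/
def HasProfile (u : CoordFun) (F : ℝ → ℝ) : Prop :=
  ∀ θ ∈ Ioo 0 Real.pi, ∀ φ, u θ φ = F θ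

theorem HasProfile.dTheta {u : CoordFun} {F : ℝ → ℝ} (h : HasProfile u F) :
    HasProfile (dTheta u) (deriv F) := fun _ hθ φ =>
  Filter.EventuallyEq.deriv_eq <| Filter.eventually_of_mem (Ioo_mem_nhds hθ.1 hθ.2)
    fun t ht => h t ht φ

theorem HasProfile.dPhi {u : CoordFun} {F : ℝ → ℝ} (h : HasProfile u F) {θ : ℝ}
    (hθ : θ ∈ Ioo 0 Real.pi) (φ : ℝ) : dPhi u θ φ = 0 := by
  rw [AxisymmetricSphere.dPhi, show (fun s => u θ s) = fun _ => F θ from funext (h θ hθ),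
    deriv_const]

theorem HasProfile.opA {u : CoordFun} {F : ℝ → ℝ} (h : HasProfile u F) :
    HasProfile (opA u) (profA F) :=
  h.dTheta.dTheta

theorem HasProfile.opB {u : CoordFun} {F : ℝ → ℝ} (h : HasProfile u F) :
    HasProfile (opB u) (profB F) := by
  intro θ hθ φ
  rw [AxisymmetricSphere.opB, h.dTheta θ hθ,
    profB_of_sin_ne_zero F (Real.sin_pos_of_mem_Ioo hθ).ne', Real.cot_eq_cos_div_sin]
  ring

theorem HasProfile.sphLaplacian {u : CoordFun} {F : ℝ → ℝ} (h : HasProfile u F)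
    (hF : IsProfile 2 F) : HasProfile (sphLaplacian u) (letter 1 1 F) := by
  intro θ hθ φ
  have hs := (Real.sin_pos_of_mem_Ioo hθ).ne'
  have h1 : HasProfile (fun t s => Real.sin t * AxisymmetricSphere.dTheta u t s)
      (fun t => Real.sin t * deriv F t) := fun t ht s => by
    beta_reduce
    rw [h.dTheta t ht s]
  have h2 : HasProfile
      (fun t s => Real.sin t * ((Real.sin t ^ 2)⁻¹ * AxisymmetricSphere.dPhi u t s))
      (fun _ => 0) := fun t ht s => by
    beta_reduce
    rw [h.dPhi ht s, mul_zero, mul_zero]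
  have h3 := (Real.hasDerivAt_sin θ).mul (hF.differentiable_deriv (n := 0) θ).hasDerivAt
  have h4 : deriv (fun t => Real.sin t * deriv F t) θ = _ := h3.deriv
  rw [AxisymmetricSphere.sphLaplacian, h1.dTheta θ hθ φ, h2.dPhi hθ φ, h4]
  simp only [letter, Pi.add_apply, Pi.smul_apply, smul_eq_mul, profB_of_sin_ne_zero F hs, profA]
  field_simp
  ring

theorem HasProfile.sphLaplacian_iterate {u : CoordFun} {F : ℝ → ℝ} (h : HasProfile u F)
    {n : ℕ} (hF : IsProfile n F) (i : ℕ) (hi : 2 * i ≤ n) :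
    HasProfile (AxisymmetricSphere.sphLaplacian^[i] u) ((letter 1 1)^[i] F) := by
  induction i with
  | zero => exact h
  | succ i ih =>
    rw [Function.iterate_succ_apply', Function.iterate_succ_apply']
    refine (ih (by omega)).sphLaplacian ?_
    rw [← wordOp_replicate]
    exact hF.wordOp _ (by rw [List.length_replicate]; omega)

theorem HasProfile.normL2_eq {u : CoordFun} {F : ℝ → ℝ} (h : HasProfile u F) :
    normL2 u = profNorm F :=
  normL2_congr fun θ hθ φ => by rw [h θ hθ φ]

theorem HasProfile.normL2_sphGradient {u : CoordFun} {F : ℝ → ℝ} (h : HasProfile u F) :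
    normL2 (sphGradient u) = profNorm (deriv F) :=
  normL2_congr fun θ hθ φ => by
    rw [sphGradient, h.dTheta θ hθ, h.dPhi hθ, EuclideanSpace.norm_eq]
    simp [Real.sqrt_sq_eq_abs]

/-- Finiteness turns a constant for each operator into one depending on `l` alone. -/
theorem finite_opC (l : ℕ) : (opC l).Finite := by
  induction l with
  | zero => exact finite_singleton _
  | succ l ih =>
    refine ((ih.image fun S => opA ∘ S).union (ih.image fun S => opB ∘ S)).subset ?_
    rintro T ⟨S, hS, rfl | rfl⟩
    · exact Or.inl ⟨S, hS, rfl⟩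
    · exact Or.inr ⟨S, hS, rfl⟩

theorem exists_wordOp_of_mem_opC {l : ℕ} : ∀ {T : CoordFun → CoordFun}, T ∈ opC l →
    ∃ w : List (ℝ × ℝ), w.length = l ∧ ∀ u F, HasProfile u F → HasProfile (T u) (wordOp w F) := by
  induction l with
  | zero =>
    rintro T rfl
    exact ⟨[], rfl, fun u F h => h⟩
  | succ l ih =>
    rintro T ⟨S, hS, hT⟩
    obtain ⟨w, hw, h⟩ := ih hS
    rcases hT with rfl | rfl
    -- The pairs (1, 0) and (0, 1) encode a and b.
    · refine ⟨(1, 0) :: w, by simp [hw], fun u F hu => ?_⟩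
      have : wordOp ((1, 0) :: w) F = profA (wordOp w F) := by
        simp [wordOp, letter]
      rw [this]
      exact (h u F hu).opA
    · refine ⟨(0, 1) :: w, by simp [hw], fun u F hu => ?_⟩
      have : wordOp ((0, 1) :: w) F = profB (wordOp w F) := by
        simp [wordOp, letter]
      rw [this]
      exact (h u F hu).opB

theorem exists_const_of_mem_opC {l : ℕ} {T : CoordFun → CoordFun} (hT : T ∈ opC l) :
    ∃ C : ℝ≥0,
      (∀ f : S2 → ℝ, ContMDiff (𝓡 2) 𝓘(ℝ, ℝ) ((2 * l : ℕ) : ℕ∞ω) f → IsAxisymmetric f →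
        normL2 (T (inCoords f)) ≤
          C * ∑ i ∈ Finset.range (l + 1), normL2 (sphLaplacian^[i] (inCoords f))) ∧
      (∀ f : S2 → ℝ, ContMDiff (𝓡 2) 𝓘(ℝ, ℝ) ((2 * l + 1 : ℕ) : ℕ∞ω) f → IsAxisymmetric f →
        normL2 (dTheta (T (inCoords f))) ≤
          C * ∑ i ∈ Finset.range (l + 1), normL2 (sphGradient (sphLaplacian^[i] (inCoords f)))) := by
  obtain ⟨w, hw, hTw⟩ := exists_wordOp_of_mem_opC hT
  -- The value α = 1 is the Laplacian; the second seminorm is the norm of the gradient of an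
  -- axisymmetric function.
  obtain ⟨C, hC⟩ := isEllipticSeminorm_profNorm.wordBound l 1 le_rfl w hw
  obtain ⟨K, hK⟩ := isEllipticSeminorm_profNorm_deriv.wordBound l 1 le_rfl w hw
  refine ⟨max C K, fun f hf hax => ?_, fun f hf hax => ?_⟩
  · have hF := hax.isProfile hf
    have hu : HasProfile (inCoords f) fun θ => inCoords f θ 0 :=
      fun θ _ φ => hax.inCoords_eq rfl φ 0
    rw [(hTw _ _ hu).normL2_eq, Finset.sum_congr rfl fun i hi =>
      (hu.sphLaplacian_iterate hF i (by rw [Finset.mem_range] at hi; omega)).normL2_eq]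
    exact (hC _ (hF.of_le (by omega))).trans
      (mul_le_mul_left (ENNReal.coe_le_coe.2 (le_max_left C K)) _)
  · have hF := hax.isProfile hf
    have hu : HasProfile (inCoords f) fun θ => inCoords f θ 0 :=
      fun θ _ φ => hax.inCoords_eq rfl φ 0
    rw [(hTw _ _ hu).dTheta.normL2_eq, Finset.sum_congr rfl fun i hi =>
      (hu.sphLaplacian_iterate hF i (by rw [Finset.mem_range] at hi; omega)).normL2_sphGradient]
    exact (hK _ (hF.of_le (by omega))).trans
      (mul_le_mul_left (ENNReal.coe_le_coe.2 (le_max_right C K)) _)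

end AxisymmetricSphere

theorem theoremA1 (l : ℕ) :
    ∃ C : ℝ≥0, ∀ T ∈ AxisymmetricSphere.opC l,
      (∀ f : AxisymmetricSphere.S2 → ℝ,
        ContMDiff (𝓡 2) 𝓘(ℝ, ℝ) ((2 * l : ℕ) : ℕ∞ω) f →
        AxisymmetricSphere.IsAxisymmetric f →
        AxisymmetricSphere.normL2 (T (AxisymmetricSphere.inCoords f)) ≤
          (C : ℝ≥0∞) * ∑ i ∈ Finset.range (l + 1),
            AxisymmetricSphere.normL2
              (AxisymmetricSphere.sphLaplacian^[i] (AxisymmetricSphere.inCoords f))) ∧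
      (∀ f : AxisymmetricSphere.S2 → ℝ,
        ContMDiff (𝓡 2) 𝓘(ℝ, ℝ) ((2 * l + 1 : ℕ) : ℕ∞ω) f →
        AxisymmetricSphere.IsAxisymmetric f →
        AxisymmetricSphere.normL2
            (AxisymmetricSphere.dTheta (T (AxisymmetricSphere.inCoords f))) ≤
          (C : ℝ≥0∞) * ∑ i ∈ Finset.range (l + 1),
            AxisymmetricSphere.normL2
              (AxisymmetricSphere.sphGradient
                (AxisymmetricSphere.sphLaplacian^[i] (AxisymmetricSphere.inCoords f)))) := by
  choose! c hc using fun (T : AxisymmetricSphere.CoordFun → AxisymmetricSphere.CoordFun)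
    (hT : T ∈ AxisymmetricSphere.opC l) => AxisymmetricSphere.exists_const_of_mem_opC hT
  refine ⟨(AxisymmetricSphere.finite_opC l).toFinset.sup c, fun T hT => ?_⟩
  have hle : (c T : ℝ≥0∞) ≤ ((AxisymmetricSphere.finite_opC l).toFinset.sup c : ℝ≥0) :=
    ENNReal.coe_le_coe.2 (Finset.le_sup (by simpa using hT))
  exact ⟨fun f hf hax => ((hc T hT).1 f hf hax).trans (mul_le_mul_left hle _),
    fun f hf hax => ((hc T hT).2 f hf hax).trans (mul_le_mul_left hle _)⟩
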